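/- **Categories.** For a category $\mathcal C$, $\mathrm{Fam}(\mathcal C)$ has as objects pairs $(X,\partial X)$ of a set $X$ and a family $(\partial X(x))_{x\in X}$ of objects of $\mathcal C$; a morphism $(X,\partial X)\to(Y,\partial Y)$ is a function $f:X\to Y$ together with morphisms $\partial f(x):\partial X(x)\to\partial Y(f(x))$ of $\mathcal C$. Let $\mathrm{LatGal}$ be the category of bounded lattices and Galois connections: a morphism $X\to Y$ is a pair of a forward map $r:X\to Y$ and a backward map $l:Y\to X$ with $l(y)\le x\iff y\le r(x)$. Let $\mathrm{MeetSLat}$ (resp. $\mathrm{JoinSLat}$) be the category of meet-semilattices with $\top$ (resp. join-semilattices with $\bot$) and maps preserving finite meets (resp. finite joins). A morphism of $\mathrm{MeetSLat}\times\mathrm{JoinSLat}^{\mathrm{op}}$ is thus a pair of unrelated forward and backward maps. Both $\mathrm{Fam}(\mathrm{LatGal})$ and $\mathcal D=\mathrm{Fam}(\mathrm{MeetSLat}\times\mathrm{JoinSLat}^{\mathrm{op}})$ have finite products and all coproducts, $\mathcal D$ is cartesian closed, and the functor $H:\mathrm{Fam}(\mathrm{LatGal})\to\mathcal D$, $H(X,\partial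 X)=(X,x\mapsto(\partial X(x),\partial X(x)))$, sending each Galois connection to its pair of adjoints, preserves finite products and coproducts. **Language.** Let $\Sigma$ be a signature: a set of primitive types $\rho$ and sets of primitive operations $\phi:\rho_1,\dots,\rho_n\to\rho$. The types are $\sigma,\tau::=\rho\mid\sigma+\tau\mid 1\mid\sigma\times\tau\mid\sigma\to\tau\mid\mathrm{list}\,\tau$, and the terms are those of the simply typed $\lambda$-calculus with variables, primitive operations, injections and case, unit, pairs and projections, abstraction and application, nil, cons and fold over lists, with the usual typing rules. A type is *first-order* if it is built from primitive types, sums, unit and products only; a context is first-order if all its types are. **Interpretations.** Fix an interpretation of $\Sigma$ in $\mathrm{Fam}(\mathrm{LatGal})$ (an object for each primitive type, a morphism $[\![\rho_1]\!]\times\dots\times[\![\rho_n]\!]\to[\![\rho]\!]$ for each operation). It extends to an interpretation $[\![-]\!]_{\mathit{fo}}$ of first-order types and contexts in $\mathrm{Fam}(\mathrm{LatGal})$ by coproducts and finite products. Transported along $H$, it gives an interpretation of $\Sigma$ in $\mathcal D$, which extends in the standard way to an interpretation $[\![-]\!]$ of all types, contexts and well-typed terms in the bicartesian closed category $\mathcal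 D$, where $[\![\mathrm{list}\,\tau]\!]=\coprod_{n\in\mathbb N}[\![\tau]\!]^n$. As $H$ preserves finite products and coproducts, there are canonical isomorphisms $\theta_\tau:H([\![\tau]\!]_{\mathit{fo}})\cong[\![\tau]\!]$ and $\theta_\Gamma:H([\![\Gamma]\!]_{\mathit{fo}})\cong[\![\Gamma]\!]$ for first-order $\tau$ and $\Gamma$, built from the comparison isomorphisms of $H$. **Theorem.** For every well-typed term $\Gamma\vdash M:\tau$ with $\Gamma$ and $\tau$ first-order (the term may use higher-order functions and lists internally), there is a morphism $g:[\![\Gamma]\!]_{\mathit{fo}}\to[\![\tau]\!]_{\mathit{fo}}$ of $\mathrm{Fam}(\mathrm{LatGal})$ such that $$H(g)=\theta_\tau^{-1}\circ[\![\Gamma\vdash M:\tau]\!]\circ\theta_\Gamma .$$ In particular, at every point $x$ of the underlying set of $[\![\Gamma]\!]_{\mathit{fo}}$, the backward and forward approximation maps of $\theta_\tau^{-1}\circ[\![\Gamma\vdash M:\tau]\!]\circ\theta_\Gamma$ at $x$ form a Galois connection, the backward map being the left adjoint. -/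

import Mathlib

open CategoryTheory CategoryTheory.Limits MonoidalCategory CartesianMonoidalCategory

universe w v₁ v₂ u₁ u₂ v u

namespace GaloisSlicing

/-! ### Families -/

section Fam

variable {C : Type u₁} [Category.{v₁} C] {D : Type u₂} [Category.{v₂} D]

/-- The category `Fam(C)` of families of objects of `C`: Mathlib calls it `FormalCoproduct`.
An object is a set `X.I` with a family `X.obj : X.I → C`, a morphism is a function `f.f` on
indices with a family `f.φ i : X.obj i ⟶ Y.obj (f.f i)`. -/
abbrev Fam (C : Type u₁) [Category.{v₁} C] := FormalCoproduct.{w} C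

theorem Fam.mk_ext {X Y : Fam.{w} C} (f : X.I → Y.I) {φ ψ : ∀ i, X.obj i ⟶ Y.obj (f i)}
    (h : ∀ i, φ i = ψ i) : (⟨f, φ⟩ : FormalCoproduct.Hom X Y) = ⟨f, ψ⟩ := by
  rw [funext h]

variable [CartesianMonoidalCategory C] [CartesianMonoidalCategory D]

/-- The product of two families: `(X × Y, (x, y) ↦ ∂X x × ∂Y y)`. -/
@[simps] def Fam.prodObj (X Y : Fam.{w} C) : Fam.{w} C where
  I := X.I × Y.I
  obj p := X.obj p.1 ⊗ Y.obj p.2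

def Fam.prodFst (X Y : Fam.{w} C) : Fam.prodObj X Y ⟶ X := ⟨Prod.fst, fun _ => fst _ _⟩
def Fam.prodSnd (X Y : Fam.{w} C) : Fam.prodObj X Y ⟶ Y := ⟨Prod.snd, fun _ => snd _ _⟩

def Fam.prodLift {Z X Y : Fam.{w} C} (f : Z ⟶ X) (g : Z ⟶ Y) : Z ⟶ Fam.prodObj X Y :=
  ⟨fun z => (f.f z, g.f z), fun z => lift (f.φ z) (g.φ z)⟩

theorem Fam.prodLift_fst {Z X Y : Fam.{w} C} (f : Z ⟶ X) (g : Z ⟶ Y) :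
    Fam.prodLift f g ≫ Fam.prodFst X Y = f :=
  Fam.mk_ext f.f fun _ => lift_fst _ _

theorem Fam.prodLift_snd {Z X Y : Fam.{w} C} (f : Z ⟶ X) (g : Z ⟶ Y) :
    Fam.prodLift f g ≫ Fam.prodSnd X Y = g :=
  Fam.mk_ext g.f fun _ => lift_snd _ _

theorem Fam.prod_uniq {Z X Y : Fam.{w} C} (m : Z ⟶ Fam.prodObj X Y) :
    m = Fam.prodLift (m ≫ Fam.prodFst X Y) (m ≫ Fam.prodSnd X Y) :=
  Fam.mk_ext m.f fun i => (lift_comp_fst_snd (m.φ i)).symm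

/-- Finite products in `Fam(C)`, chosen from those of `C`. -/
instance Fam.cartesian : CartesianMonoidalCategory (Fam.{w} C) :=
  .ofChosenFiniteProducts
    ⟨asEmptyCone ⟨PUnit, fun _ => 𝟙_ C⟩,
      IsTerminal.ofUniqueHom (fun _ => ⟨fun _ => PUnit.unit, fun _ => toUnit _⟩)
        fun _ _ => FormalCoproduct.hom_ext rfl fun _ => toUnit_unique _ _⟩
    fun X Y => ⟨BinaryFan.mk (Fam.prodFst X Y) (Fam.prodSnd X Y),
      BinaryFan.IsLimit.mk _ (fun f g => Fam.prodLift f g)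
        (fun f g => Fam.prodLift_fst f g) (fun f g => Fam.prodLift_snd f g)
        (fun f g m h₁ h₂ => by
          subst h₁ h₂; exact Fam.prod_uniq m)⟩


instance Fam.hasFiniteCoproducts : HasFiniteCoproducts (Fam.{w} C) :=
  hasFiniteCoproducts_of_hasCoproducts.{w} _

instance Fam.hasCountableCoproducts : HasCoproductsOfShape ℕ (Fam.{w} C) :=
  hasCoproducts_shrink.{0, w} ℕ

end Fam

/-! ### Biproducts and internal homs of families -/

section Closed

variable {C : Type u} [Category.{w} C]

section Hom

variable [HasProducts.{w} C]

/-- The internal hom of families: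
`(Π x, Σ y, C(∂X x, ∂Y y), f ↦ Π x, ∂Y (π₁ (f x)))`. -/
noncomputable def Fam.hom (X Y : Fam.{w} C) : Fam.{w} C where
  I := ∀ x : X.I, Σ y : Y.I, X.obj x ⟶ Y.obj y
  obj f := ∏ᶜ fun x => Y.obj (f x).1

/-- A morphism into the internal hom, from its components. -/
noncomputable def Fam.homMk {X Y Z : Fam.{w} C} (y : Z.I → X.I → Y.I)
    (l : ∀ z x, X.obj x ⟶ Y.obj (y z x)) (r : ∀ z x, Z.obj z ⟶ Y.obj (y z x)) :
    Z ⟶ Fam.hom X Y :=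
  ⟨fun z x => ⟨y z x, l z x⟩, fun z => Pi.lift fun x => r z x⟩

theorem Fam.homMk_congr {X Y Z : Fam.{w} C} {y : Z.I → X.I → Y.I}
    {l l' : ∀ z x, X.obj x ⟶ Y.obj (y z x)} {r r' : ∀ z x, Z.obj z ⟶ Y.obj (y z x)}
    (hl : ∀ z x, l z x = l' z x) (hr : ∀ z x, r z x = r' z x) :
    Fam.homMk y l r = Fam.homMk y l' r' := by
  rw [funext fun z => funext (hl z), funext fun z => funext (hr z)]

theorem Fam.homMk_eta {X Y Z : Fam.{w} C} (k : Z ⟶ Fam.hom X Y) :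
    Fam.homMk (fun z x => (k.f z x).1) (fun z x => (k.f z x).2)
      (fun z x => k.φ z ≫ Pi.π (fun x => Y.obj (k.f z x).1) x) = k :=
  Fam.mk_ext k.f fun z => by
    apply Pi.hom_ext
    intro x
    exact Pi.lift_π _ _

end Hom

variable [CartesianMonoidalCategory C] [HasZeroMorphisms C]

/-- The chosen finite products of `C` are biproducts: `(1, 0) : X ⟶ X ⊗ Y` and
`(0, 1) : Y ⟶ X ⊗ Y` form a coproduct diagram. -/
class HasBiproducts (C : Type u) [Category.{w} C] [CartesianMonoidalCategory C]
    [HasZeroMorphisms C] : Prop where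
  isColimit (X Y : C) : Nonempty (IsColimit
    (BinaryCofan.mk (lift (𝟙 X) (0 : X ⟶ Y)) (lift (0 : Y ⟶ X) (𝟙 Y))))

/-- First injection into the biproduct. -/
abbrev biInl (X Y : C) : X ⟶ X ⊗ Y := lift (𝟙 X) 0

/-- Second injection into the biproduct. -/
abbrev biInr (X Y : C) : Y ⟶ X ⊗ Y := lift 0 (𝟙 Y)

theorem biInl_whisker {A B B' : C} (h : B' ⟶ B) :
    biInl A B' ≫ lift (fst A B' ≫ 𝟙 A) (snd A B' ≫ h) = biInl A B := by
  apply CartesianMonoidalCategory.hom_ext <;> simp [biInl]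

theorem biInr_whisker {A B B' : C} (h : B' ⟶ B) :
    biInr A B' ≫ lift (fst A B' ≫ 𝟙 A) (snd A B' ≫ h) = h ≫ biInr A B := by
  apply CartesianMonoidalCategory.hom_ext <;> simp [biInr]

variable [HasBiproducts C]

/-- Copairing out of the biproduct. -/
noncomputable def biDesc {X Y Z : C} (f : X ⟶ Z) (g : Y ⟶ Z) : X ⊗ Y ⟶ Z :=
  (BinaryCofan.IsColimit.desc' (HasBiproducts.isColimit X Y).some f g).1

theorem biInl_desc {X Y Z : C} (f : X ⟶ Z) (g : Y ⟶ Z) : biInl X Y ≫ biDesc f g = f :=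
  (BinaryCofan.IsColimit.desc' (HasBiproducts.isColimit X Y).some f g).2.1

theorem biInr_desc {X Y Z : C} (f : X ⟶ Z) (g : Y ⟶ Z) : biInr X Y ≫ biDesc f g = g :=
  (BinaryCofan.IsColimit.desc' (HasBiproducts.isColimit X Y).some f g).2.2

theorem biDesc_eta {X Y Z : C} (m : X ⊗ Y ⟶ Z) :
    biDesc (biInl X Y ≫ m) (biInr X Y ≫ m) = m :=
  BinaryCofan.IsColimit.hom_ext (HasBiproducts.isColimit X Y).some
    (biInl_desc _ _) (biInr_desc _ _)

variable [HasProducts.{w} C]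

/-- Currying for families. -/
noncomputable def Fam.curryEquiv (X Z Y : Fam.{w} C) : (X ⊗ Z ⟶ Y) ≃ (Z ⟶ Fam.hom X Y) where
  toFun m := Fam.homMk (fun z x => m.f (x, z)) (fun z x => biInl _ _ ≫ m.φ (x, z))
    (fun z x => biInr _ _ ≫ m.φ (x, z))
  invFun k := ⟨fun p => (k.f p.2 p.1).1, fun p => biDesc (k.f p.2 p.1).2
    (k.φ p.2 ≫ Pi.π (fun x => Y.obj (k.f p.2 x).1) p.1)⟩
  left_inv m := Fam.mk_ext m.f fun p => by
    refine Eq.trans ?_ (biDesc_eta (m.φ p))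
    congr 1
    exact Pi.lift_π _ _
  right_inv k := by
    refine Eq.trans ?_ (Fam.homMk_eta k)
    exact Fam.homMk_congr (fun z x => biInl_desc _ _) (fun z x => biInr_desc _ _)

theorem Fam.curryEquiv_naturality (X : Fam.{w} C) (Z' Z Y : Fam.{w} C) (f : Z' ⟶ Z)
    (g : X ⊗ Z ⟶ Y) :
    Fam.curryEquiv X Z' Y ((tensorLeft X).map f ≫ g) = f ≫ Fam.curryEquiv X Z Y g := by
  have key : f ≫ Fam.curryEquiv X Z Y g = Fam.homMk (fun z x => g.f (x, f.f z))
      (fun z x => biInl _ _ ≫ g.φ (x, f.f z))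
      (fun z x => f.φ z ≫ biInr _ _ ≫ g.φ (x, f.f z)) :=
    Fam.mk_ext _ fun z => by
      apply Pi.hom_ext
      intro x
      refine (Category.assoc _ _ _).trans (Eq.trans ?_
        (Pi.lift_π (fun x => f.φ z ≫ biInr _ _ ≫ g.φ (x, f.f z)) x).symm)
      exact congrArg (f.φ z ≫ ·) (Pi.lift_π _ _)
  refine Eq.trans ?_ key.symm
  refine Fam.homMk_congr (fun z x => ?_) (fun z x => ?_)
  · refine (Category.assoc _ _ _).symm.trans (congrArg (· ≫ g.φ (x, f.f z)) ?_)
    exact biInl_whisker (f.φ z)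
  · refine (Category.assoc _ _ _).symm.trans (Eq.trans
      (congrArg (· ≫ g.φ (x, f.f z)) ?_) (Category.assoc _ _ _))
    exact biInr_whisker (f.φ z)

/-- `Fam(C)` is cartesian closed if `C` has biproducts and all products. -/
noncomputable instance Fam.closed : MonoidalClosed (Fam.{w} C) where
  closed X :=
    { rightAdj := Adjunction.rightAdjointOfEquiv (F := tensorLeft X) (Fam.curryEquiv X)
        (Fam.curryEquiv_naturality X)
      adj := Adjunction.adjunctionOfEquivRight (F := tensorLeft X) (Fam.curryEquiv X)
        (Fam.curryEquiv_naturality X) }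

end Closed

/-! ### The category `MeetSLat × JoinSLatᵒᵖ` -/

section MeetJoin

/-- The category `MeetSLat × JoinSLatᵒᵖ`; a morphism is a pair of a forward finite-meet preserving
map and a backward finite-join preserving map, not required to be related. -/
abbrev MeetJoin := SemilatInfCat.{u} × SemilatSupCat.{u}ᵒᵖ

namespace MeetJoin

/-- The meet-semilattice of an object. -/
abbrev Meet (X : MeetJoin.{u}) : Type u := X.1.X

/-- The join-semilattice of an object. -/
abbrev Join (X : MeetJoin.{u}) : Type u := X.2.unop.X

/-- The object with given meet-semilattice and join-semilattice. -/
abbrev mk (M J : Type u) [SemilatticeInf M] [OrderTop M] [SemilatticeSup J] [OrderBot J] :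
    MeetJoin.{u} :=
  (SemilatInfCat.of M, Opposite.op (SemilatSupCat.of J))

/-- The forward map of a morphism. -/
def fwd {X Y : MeetJoin.{u}} (f : X ⟶ Y) : InfTopHom X.Meet Y.Meet := f.1

/-- The backward map of a morphism. -/
def bwd {X Y : MeetJoin.{u}} (f : X ⟶ Y) : SupBotHom Y.Join X.Join := f.2.unop

/-- The morphism with given forward and backward maps. -/
def homMk {X Y : MeetJoin.{u}} (f : InfTopHom X.Meet Y.Meet) (g : SupBotHom Y.Join X.Join) :
    X ⟶ Y :=
  (f, Quiver.Hom.op (V := SemilatSupCat.{u}) (X := Y.2.unop) (Y := X.2.unop) g)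

theorem hom_ext {X Y : MeetJoin.{u}} {f g : X ⟶ Y} (h₁ : ∀ x, fwd f x = fwd g x)
    (h₂ : ∀ y, bwd f y = bwd g y) : f = g :=
  Prod.ext (InfTopHom.ext h₁) (Quiver.Hom.unop_inj (SupBotHom.ext h₂))

theorem fwd_comp {X Y Z : MeetJoin.{u}} (f : X ⟶ Y) (g : Y ⟶ Z) (x : X.Meet) :
    fwd (f ≫ g) x = fwd g (fwd f x) := rfl

theorem bwd_comp {X Y Z : MeetJoin.{u}} (f : X ⟶ Y) (g : Y ⟶ Z) (z : Z.Join) :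
    bwd (f ≫ g) z = bwd f (bwd g z) := rfl

/-- The zero morphisms: constantly `⊤` forwards and constantly `⊥` backwards. -/
instance : HasZeroMorphisms MeetJoin.{u} where
  zero _ _ := ⟨homMk ⟨⟨fun _ => ⊤, fun _ _ => (inf_idem _).symm⟩, rfl⟩
    ⟨⟨fun _ => ⊥, fun _ _ => (sup_idem _).symm⟩, rfl⟩⟩
  comp_zero f _ := hom_ext (fun _ => rfl) (fun _ => map_bot (bwd f))
  zero_comp _ _ _ f := hom_ext (fun _ => map_top (fwd f)) (fun _ => rfl)

theorem fwd_zero (X Y : MeetJoin.{u}) (x : X.Meet) : fwd (0 : X ⟶ Y) x = ⊤ := rfl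

theorem bwd_zero (X Y : MeetJoin.{u}) (y : Y.Join) : bwd (0 : X ⟶ Y) y = ⊥ := rfl

/-- Binary products, formed on the underlying sets. -/
abbrev prodObj (X Y : MeetJoin.{u}) : MeetJoin.{u} := mk (X.Meet × Y.Meet) (X.Join × Y.Join)

def prodFst (X Y : MeetJoin.{u}) : prodObj X Y ⟶ X :=
  homMk ⟨⟨Prod.fst, fun _ _ => rfl⟩, rfl⟩
    ⟨⟨fun x => (x, ⊥), fun _ _ => Prod.ext rfl (sup_idem _).symm⟩, rfl⟩

def prodSnd (X Y : MeetJoin.{u}) : prodObj X Y ⟶ Y :=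
  homMk ⟨⟨Prod.snd, fun _ _ => rfl⟩, rfl⟩
    ⟨⟨fun x => (⊥, x), fun _ _ => Prod.ext (sup_idem _).symm rfl⟩, rfl⟩

def prodLift {X Y Z : MeetJoin.{u}} (f : Z ⟶ X) (g : Z ⟶ Y) : Z ⟶ prodObj X Y :=
  homMk ⟨⟨fun z => (fwd f z, fwd g z), fun _ _ => Prod.ext (map_inf _ _ _) (map_inf _ _ _)⟩,
      Prod.ext (map_top (fwd f)) (map_top (fwd g))⟩
    ⟨⟨fun p => bwd f p.1 ⊔ bwd g p.2, fun p q =>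
        (congrArg₂ (· ⊔ ·) (map_sup (bwd f) p.1 q.1) (map_sup (bwd g) p.2 q.2)).trans
          (sup_sup_sup_comm _ _ _ _)⟩,
      (congrArg₂ (· ⊔ ·) (map_bot (bwd f)) (map_bot (bwd g))).trans (sup_idem _)⟩

def terminalLift (X : MeetJoin.{u}) : X ⟶ mk PUnit.{u+1} PUnit.{u+1} :=
  homMk ⟨⟨fun _ => ⊤, fun _ _ => rfl⟩, rfl⟩
    ⟨⟨fun _ => ⊥, fun _ _ => (sup_idem _).symm⟩, rfl⟩

theorem prodLift_eta {X Y Z : MeetJoin.{u}} (m : Z ⟶ prodObj X Y) :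
    m = prodLift (m ≫ prodFst X Y) (m ≫ prodSnd X Y) :=
  hom_ext (fun _ => rfl) fun y => by
    have : y = ((y.1, ⊥) ⊔ (⊥, y.2) : X.Join × Y.Join) :=
      Prod.ext (sup_bot_eq _).symm (bot_sup_eq _).symm
    exact (congrArg (bwd m) this).trans (map_sup (bwd m) _ _)

instance : CartesianMonoidalCategory MeetJoin.{u} :=
  .ofChosenFiniteProducts
    ⟨asEmptyCone (mk PUnit.{u+1} PUnit.{u+1}),
      IsTerminal.ofUniqueHom terminalLift
        fun _ m => hom_ext (fun _ => rfl) (fun _ => map_bot (bwd m))⟩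
    fun X Y => ⟨BinaryFan.mk (prodFst X Y) (prodSnd X Y),
      BinaryFan.IsLimit.mk _ (fun f g => prodLift f g)
        (fun f g => hom_ext (fun _ => rfl) fun x => by
          refine Eq.trans (congrArg (bwd f x ⊔ ·) (map_bot (bwd g))) (sup_bot_eq _))
        (fun f g => hom_ext (fun _ => rfl) fun x => by
          refine Eq.trans (congrArg (· ⊔ bwd g x) (map_bot (bwd f))) (bot_sup_eq _))
        (fun f g m h₁ h₂ => by subst h₁ h₂; exact prodLift_eta m)⟩


/-- Copairing out of the biproduct. -/
def coprodDesc {X Y Z : MeetJoin.{u}} (f : X ⟶ Z) (g : Y ⟶ Z) : prodObj X Y ⟶ Z :=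
  homMk ⟨⟨fun p => fwd f p.1 ⊓ fwd g p.2, fun p q =>
        (congrArg₂ (· ⊓ ·) (map_inf (fwd f) p.1 q.1) (map_inf (fwd g) p.2 q.2)).trans
          (inf_inf_inf_comm _ _ _ _)⟩,
      (congrArg₂ (· ⊓ ·) (map_top (fwd f)) (map_top (fwd g))).trans (inf_idem _)⟩
    ⟨⟨fun z => (bwd f z, bwd g z), fun _ _ => Prod.ext (map_sup _ _ _) (map_sup _ _ _)⟩,
      Prod.ext (map_bot (bwd f)) (map_bot (bwd g))⟩

instance : HasBiproducts MeetJoin.{u} where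
  isColimit X Y := ⟨BinaryCofan.IsColimit.mk _ (fun f g => coprodDesc f g)
    (fun f g => hom_ext
      (fun x => Eq.trans (congrArg (fwd f x ⊓ ·) (map_top (fwd g))) (inf_top_eq _))
      (fun z => sup_bot_eq (bwd f z)))
    (fun f g => hom_ext
      (fun x => Eq.trans (congrArg (· ⊓ fwd g x) (map_top (fwd f))) (top_inf_eq _))
      (fun z => bot_sup_eq (bwd g z)))
    (fun {Z} f g (m : prodObj X Y ⟶ Z) h₁ h₂ => by
      subst h₁ h₂
      refine hom_ext (fun p => ?_) (fun z => ?_)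
      · have : p = ((p.1, ⊤) ⊓ (⊤, p.2) : X.Meet × Y.Meet) :=
          Prod.ext (inf_top_eq _).symm (top_inf_eq _).symm
        exact (congrArg (fwd m) this).trans (map_inf (fwd m) _ _)
      · exact Prod.ext (sup_bot_eq (bwd m z).1).symm (bot_sup_eq (bwd m z).2).symm)⟩

/-- The coproduct of a family of join-semilattices: the families with finitely many
non-`⊥` entries. -/
def FinSum {J : Type u} (L : J → Type u) [∀ j, SemilatticeSup (L j)] [∀ j, OrderBot (L j)] :
    Type u :=
  {f : ∀ j, L j // {j | f j ≠ ⊥}.Finite}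

namespace FinSum

variable {J : Type u} {L : J → Type u} [∀ j, SemilatticeSup (L j)] [∀ j, OrderBot (L j)]

instance : SemilatticeSup (FinSum L) :=
  Subtype.semilatticeSup fun {f g} hf hg => (hf.union hg).subset fun j hj => by
    by_contra h
    simp only [Set.mem_union, Set.mem_ofPred_eq, not_or, not_not] at h
    exact hj (by simp [h.1, h.2])

instance : OrderBot (FinSum L) :=
  Subtype.orderBot (by simp)

open Classical in
/-- The family with a single prescribed entry. -/
noncomputable def single (j : J) : SupBotHom (L j) (FinSum L) where
  toFun x := ⟨Function.update ⊥ j x, (Set.finite_singleton j).subset fun i hi => by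
    by_contra h
    exact hi (by rw [Function.update_of_ne h]; rfl)⟩
  map_sup' x y := Subtype.ext (funext fun i => by
    change Function.update ⊥ j (x ⊔ y) i = Function.update ⊥ j x i ⊔ Function.update ⊥ j y i
    by_cases h : i = j
    · subst h; simp
    · simp [Function.update_of_ne h])
  map_bot' := Subtype.ext (Function.update_eq_self j ⊥)

variable {Z : Type u} [SemilatticeSup Z] [OrderBot Z]

theorem sup_eq (φ : ∀ j, SupBotHom (L j) Z) (f : FinSum L) (S : Finset J)
    (hS : f.2.toFinset ⊆ S) :
    f.2.toFinset.sup (fun j => φ j (f.1 j)) = S.sup fun j => φ j (f.1 j) := by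
  refine le_antisymm (Finset.sup_mono hS) (Finset.sup_le fun j _ => ?_)
  by_cases h : f.1 j = ⊥
  · simp [h]
  · exact Finset.le_sup (f := fun j => φ j (f.1 j)) (by simpa using h)

open Classical in
/-- Copairing out of the coproduct. -/
noncomputable def desc (φ : ∀ j, SupBotHom (L j) Z) : SupBotHom (FinSum L) Z where
  toFun f := f.2.toFinset.sup fun j => φ j (f.1 j)
  map_sup' f g := by
    have h : (f ⊔ g).2.toFinset ⊆ f.2.toFinset ∪ g.2.toFinset := fun j hj => by
      by_contra h
      simp only [Finset.mem_union, Set.Finite.mem_toFinset, Set.mem_ofPred_eq, not_or,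
        not_not] at h hj
      refine hj ?_
      change f.1 j ⊔ g.1 j = ⊥
      simp [h.1, h.2]
    rw [sup_eq φ (f ⊔ g) _ h, sup_eq φ f _ Finset.subset_union_left,
      sup_eq φ g _ Finset.subset_union_right, ← Finset.sup_sup]
    exact Finset.sup_congr rfl fun j _ => map_sup (φ j) (f.1 j) (g.1 j)
  map_bot' := by
    refine le_bot_iff.1 (Finset.sup_le fun j _ => ?_)
    exact (map_bot (φ j)).le

theorem desc_single (φ : ∀ j, SupBotHom (L j) Z) (j : J) (x : L j) :
    desc φ (single j x) = φ j x := by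
  classical
  have h : (single j x).2.toFinset ⊆ {j} := fun i hi => by
    by_contra h
    refine (Set.Finite.mem_toFinset _).1 hi ?_
    exact Function.update_of_ne (by simpa using h) x ⊥
  refine (sup_eq φ _ _ h).trans ?_
  rw [Finset.sup_singleton]
  exact congrArg (φ j) (Function.update_self j x ⊥)

theorem eq_sup_single (f : FinSum L) :
    f = f.2.toFinset.sup fun j => single j (f.1 j) := by
  classical
  refine le_antisymm ?_ (Finset.sup_le fun j _ => ?_)
  · intro j
    by_cases h : f.1 j = ⊥
    · rw [h]; exact bot_le
    · have h1 : single j (f.1 j) ≤ f.2.toFinset.sup fun j => single j (f.1 j) :=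
        Finset.le_sup (f := fun j => single j (f.1 j)) (by simpa using h)
      exact (Function.update_self j (f.1 j) ⊥).ge.trans (h1 j)
  · intro i
    change Function.update ⊥ j (f.1 j) i ≤ f.1 i
    by_cases h : i = j
    · subst h; simp
    · rw [Function.update_of_ne h]; exact bot_le

theorem hom_eq_desc (m : SupBotHom (FinSum L) Z) (f : FinSum L) :
    m f = desc (fun j => m.comp (single j)) f := by
  conv_lhs => rw [eq_sup_single f]
  exact map_finset_sup m _ _

end FinSum

/-- The product of a family of objects. -/
abbrev piObj {J : Type u} (X : J → MeetJoin.{u}) : MeetJoin.{u} :=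
  mk (∀ j, (X j).Meet) (FinSum fun j => (X j).Join)

/-- The projections from the product of a family of objects. -/
noncomputable def piProj {J : Type u} (X : J → MeetJoin.{u}) (j : J) : piObj X ⟶ X j :=
  homMk ⟨⟨fun f => f j, fun _ _ => rfl⟩, rfl⟩ (FinSum.single (L := fun j => (X j).Join) j)

/-- Tupling into the product of a family of objects. -/
noncomputable def piLift {J : Type u} {X : J → MeetJoin.{u}} {Z : MeetJoin.{u}}
    (f : ∀ j, Z ⟶ X j) : Z ⟶ piObj X :=
  homMk ⟨⟨fun z j => fwd (f j) z, fun _ _ => funext fun _ => map_inf _ _ _⟩,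
      funext fun j => map_top (fwd (f j))⟩
    (FinSum.desc (L := fun j => (X j).Join) fun j => bwd (f j))

theorem piLift_proj {J : Type u} {X : J → MeetJoin.{u}} {Z : MeetJoin.{u}}
    (f : ∀ j, Z ⟶ X j) (j : J) : piLift f ≫ piProj X j = f j :=
  hom_ext (fun _ => rfl)
    fun y => FinSum.desc_single (L := fun j => (X j).Join) (fun j => bwd (f j)) j y

theorem piLift_eta {J : Type u} {X : J → MeetJoin.{u}} {Z : MeetJoin.{u}}
    (m : Z ⟶ piObj X) : m = piLift fun j => m ≫ piProj X j :=
  hom_ext (fun _ => rfl) fun y => FinSum.hom_eq_desc (L := fun j => (X j).Join) (bwd m) y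

instance : HasProducts.{u} MeetJoin.{u} :=
  hasProducts_of_limit_fans (fun X => Fan.mk (piObj X) (piProj X)) fun _ =>
    Fan.IsLimit.mk _ (fun s => piLift s.proj) (fun s j => piLift_proj s.proj j)
      fun _ m h => (piLift_eta m).trans (congrArg piLift (funext h))

end MeetJoin

end MeetJoin


/-! ### Bounded lattices and Galois connections, and the embedding -/

/-- A bounded lattice, as an object of the category `LatGal`. -/
structure LatGal : Type (u + 1) where
  carrier : Type u
  [lattice : Lattice carrier]
  [bounded : BoundedOrder carrier]

namespace LatGal

attribute [instance] lattice bounded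

/-- A morphism `X ⟶ Y` of `LatGal`: a Galois connection whose right adjoint `fwd` goes forward and
whose left adjoint `bwd` goes backward: `bwd y ≤ x ↔ y ≤ fwd x`. -/
@[ext] structure Hom (X Y : LatGal.{u}) where
  fwd : X.carrier → Y.carrier
  bwd : Y.carrier → X.carrier
  gc : GaloisConnection bwd fwd

instance : Category LatGal.{u} where
  Hom := Hom
  id X := ⟨id, id, GaloisConnection.id⟩
  comp f g := ⟨g.fwd ∘ f.fwd, f.bwd ∘ g.bwd, g.gc.compose f.gc⟩

theorem hom_ext {X Y : LatGal.{u}} {f g : X ⟶ Y} (h₁ : ∀ x, f.fwd x = g.fwd x)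
    (h₂ : ∀ y, f.bwd y = g.bwd y) : f = g :=
  Hom.ext (funext h₁) (funext h₂)

/-- Binary products, formed on the underlying sets. -/
abbrev prodObj (X Y : LatGal.{u}) : LatGal.{u} := ⟨X.carrier × Y.carrier⟩

def prodFst (X Y : LatGal.{u}) : prodObj X Y ⟶ X :=
  ⟨Prod.fst, fun x => (x, ⊥), fun _ _ => ⟨fun h => h.1, fun h => ⟨h, bot_le⟩⟩⟩

def prodSnd (X Y : LatGal.{u}) : prodObj X Y ⟶ Y :=
  ⟨Prod.snd, fun y => (⊥, y), fun _ _ => ⟨fun h => h.2, fun h => ⟨bot_le, h⟩⟩⟩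

def prodLift {X Y Z : LatGal.{u}} (f : Z ⟶ X) (g : Z ⟶ Y) : Z ⟶ prodObj X Y :=
  ⟨fun z => (f.fwd z, g.fwd z), fun p => f.bwd p.1 ⊔ g.bwd p.2, fun _ _ =>
    sup_le_iff.trans (and_congr (f.gc _ _) (g.gc _ _))⟩

def terminalLift (X : LatGal.{u}) : X ⟶ ⟨PUnit.{u+1}⟩ :=
  ⟨fun _ => ⊤, fun _ => ⊥, fun _ _ => ⟨fun _ => trivial, fun _ => bot_le⟩⟩

theorem prodLift_eta {X Y Z : LatGal.{u}} (m : Z ⟶ prodObj X Y) :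
    m = prodLift (m ≫ prodFst X Y) (m ≫ prodSnd X Y) :=
  hom_ext (fun _ => rfl) fun y => by
    have : y = ((y.1, ⊥) ⊔ (⊥, y.2) : X.carrier × Y.carrier) :=
      Prod.ext (sup_bot_eq _).symm (bot_sup_eq _).symm
    exact (congrArg m.bwd this).trans m.gc.l_sup

instance : CartesianMonoidalCategory LatGal.{u} :=
  .ofChosenFiniteProducts
    ⟨asEmptyCone ⟨PUnit.{u+1}⟩,
      IsTerminal.ofUniqueHom terminalLift
        fun _ m => hom_ext (fun _ => rfl) (fun _ => m.gc.l_bot)⟩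
    fun X Y => ⟨BinaryFan.mk (prodFst X Y) (prodSnd X Y),
      BinaryFan.IsLimit.mk _ (fun f g => prodLift f g)
        (fun f g => hom_ext (fun _ => rfl) fun x =>
          Eq.trans (congrArg (f.bwd x ⊔ ·) g.gc.l_bot) (sup_bot_eq _))
        (fun f g => hom_ext (fun _ => rfl) fun x =>
          Eq.trans (congrArg (· ⊔ g.bwd x) f.gc.l_bot) (bot_sup_eq _))
        (fun f g m h₁ h₂ => by subst h₁ h₂; exact prodLift_eta m)⟩

/-- The functor `LatGal ⥤ MeetSLat × JoinSLatᵒᵖ` sending `X` to `(X, X)` and a Galois connection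
to its pair of adjoints. -/
def toMeetJoin : LatGal.{u} ⥤ MeetJoin.{u} where
  obj X := MeetJoin.mk X.carrier X.carrier
  map f := MeetJoin.homMk ⟨⟨f.fwd, fun _ _ => f.gc.u_inf⟩, f.gc.u_top⟩
    ⟨⟨f.bwd, fun _ _ => f.gc.l_sup⟩, f.gc.l_bot⟩

instance : PreservesFiniteProducts toMeetJoin.{u} := by
  have (X Y : LatGal.{u}) : IsIso (CartesianMonoidalCategory.prodComparison toMeetJoin X Y) := by
    have : CartesianMonoidalCategory.prodComparison toMeetJoin X Y = 𝟙 (MeetJoin.mk _ _) :=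
      MeetJoin.hom_ext (fun _ => rfl)
        fun y => Prod.ext (sup_bot_eq y.1) (bot_sup_eq y.2)
    rw [this]
    exact IsIso.id (MeetJoin.mk (X.carrier × Y.carrier) (X.carrier × Y.carrier))
  have : IsIso (CartesianMonoidalCategory.terminalComparison toMeetJoin.{u}) := by
    have : CartesianMonoidalCategory.terminalComparison toMeetJoin.{u} = 𝟙 (MeetJoin.mk _ _) :=
      MeetJoin.hom_ext (fun _ => rfl) (fun _ => rfl)
    rw [this]
    exact IsIso.id (MeetJoin.mk PUnit.{u+1} PUnit.{u+1})
  have := preservesLimit_empty_of_isIso_terminalComparison toMeetJoin.{u}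
  have := preservesLimitsOfShape_discrete_walkingPair_of_isIso_prodComparison toMeetJoin.{u}
  have := preservesLimitsOfShape_pempty_of_preservesTerminal toMeetJoin.{u}
  exact .of_preserves_binary_and_terminal _

end LatGal

section FamMap

variable {C : Type u₁} [Category.{v₁} C] {D : Type u₂} [Category.{v₂} D]

/-- The action of `Fam` on functors, applying `F` to every member of a family. -/
@[simps] def Fam.map (F : C ⥤ D) : Fam.{w} C ⥤ Fam.{w} D where
  obj X := ⟨X.I, fun i => F.obj (X.obj i)⟩
  map f := ⟨f.f, fun i => F.map (f.φ i)⟩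
  map_id _ := Fam.mk_ext _ fun _ => F.map_id _
  map_comp _ _ := Fam.mk_ext _ fun _ => F.map_comp _ _

/-- Copairing out of the image under `Fam.map F` of an explicit coproduct of families. -/
def Fam.mapCofanDesc (F : C ⥤ D) {J : Type w} {f : J → Fam.{w} C} {T : Fam.{w} D}
    (t : ∀ j, (Fam.map F).obj (f j) ⟶ T) :
    (Fam.map F).obj (FormalCoproduct.cofan J f).pt ⟶ T :=
  ⟨fun p => (t p.1).f p.2, fun p => (t p.1).φ p.2⟩

/-- `Fam.map F` sends the explicit coproduct of families to a coproduct. -/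
def Fam.mapCofanIsColimit (F : C ⥤ D) {J : Type w} (f : J → Fam.{w} C) :
    IsColimit (Cofan.mk ((Fam.map F).obj (FormalCoproduct.cofan J f).pt)
      fun j => (Fam.map F).map ((FormalCoproduct.cofan J f).inj j)) :=
  Cofan.IsColimit.mk _ (fun t => Fam.mapCofanDesc F t.inj)
    (fun t j => Fam.mk_ext (t.inj j).f fun i =>
      (congrArg (· ≫ (t.inj j).φ i) (F.map_id _)).trans (Category.id_comp _))
    (fun t (m : (Fam.map F).obj (FormalCoproduct.cofan J f).pt ⟶ t.pt) h =>
      (Fam.mk_ext m.f fun p => ((congrArg (· ≫ m.φ p) (F.map_id _)).trans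
        (Category.id_comp _)).symm).trans (congrArg (Fam.mapCofanDesc F) (funext h)))

instance Fam.map_preservesCoproducts (F : C ⥤ D) (J : Type w) :
    PreservesColimitsOfShape (Discrete J) (Fam.map.{w} F) := by
  have (f : J → Fam.{w} C) : PreservesColimit (Discrete.functor f) (Fam.map.{w} F) :=
    preservesColimit_of_preserves_colimit_cocone (FormalCoproduct.isColimitCofan J f)
      ((Cofan.isColimitMapCoconeEquiv _ _ _).symm (Fam.mapCofanIsColimit F f))
  exact preservesColimitsOfShape_of_discrete _

instance Fam.map_preservesFiniteCoproducts (F : C ⥤ D) :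
    PreservesFiniteCoproducts (Fam.map.{w} F) where
  preserves n := preservesColimitsOfShape_of_equiv
    (Discrete.equivalence (Equiv.ulift.{w} (α := Fin n))) _

variable [CartesianMonoidalCategory C] [CartesianMonoidalCategory D]

instance Fam.map_preservesFiniteProducts (F : C ⥤ D) [PreservesFiniteProducts F] :
    PreservesFiniteProducts (Fam.map.{w} F) := by
  have (X Y : Fam.{w} C) : IsIso (CartesianMonoidalCategory.prodComparison (Fam.map F) X Y) := by
    have : CartesianMonoidalCategory.prodComparison (Fam.map F) X Y = (FormalCoproduct.isoOfComponents
      (X := (Fam.map F).obj (X ⊗ Y)) (Y := (Fam.map F).obj X ⊗ (Fam.map F).obj Y)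
      (Equiv.refl (X.I × Y.I)) fun p => prodComparisonIso F (X.obj p.1) (Y.obj p.2)).hom := rfl
    rw [this]
    infer_instance
  have : IsIso (CartesianMonoidalCategory.terminalComparison (Fam.map.{w} F)) := by
    have : CartesianMonoidalCategory.terminalComparison (Fam.map.{w} F) = (FormalCoproduct.isoOfComponents
      (X := (Fam.map F).obj (𝟙_ (Fam.{w} C))) (Y := 𝟙_ (Fam.{w} D))
      (Equiv.refl PUnit) fun _ => preservesTerminalIso F).hom := toUnit_unique _ _
    rw [this]
    infer_instance
  have := preservesLimit_empty_of_isIso_terminalComparison (Fam.map.{w} F)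
  have := preservesLimitsOfShape_discrete_walkingPair_of_isIso_prodComparison (Fam.map.{w} F)
  have := preservesLimitsOfShape_pempty_of_preservesTerminal (Fam.map.{w} F)
  exact .of_preserves_binary_and_terminal _

end FamMap

/-- The embedding `H : Fam(LatGal) ⥤ Fam(MeetSLat × JoinSLatᵒᵖ)`. -/
abbrev H : Fam.{u} LatGal.{u} ⥤ Fam.{u} MeetJoin.{u} := Fam.map LatGal.toMeetJoin

/-! ### The language -/

set_option linter.checkUnivs false in
/-- A signature: a set of primitive types and, for all `ρ₁, …, ρₙ` and `ρ`, a set of primitive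
operations with argument types `ρ₁, …, ρₙ` and result type `ρ`. -/
structure Signature where
  PrimTy : Type v₁
  Op : List PrimTy → PrimTy → Type v₂

/-- Types. -/
inductive Ty (P : Type v₁) : Type v₁
  | prim (ρ : P)
  | sum (σ τ : Ty P)
  | unit
  | prod (σ τ : Ty P)
  | fn (σ τ : Ty P)
  | list (τ : Ty P)

/-- First-order types: those built from primitive types, sums, unit and products. -/
def Ty.FirstOrder {P : Type v₁} : Ty P → Prop
  | prim _ => True
  | sum σ τ => σ.FirstOrder ∧ τ.FirstOrder
  | unit => True
  | prod σ τ => σ.FirstOrder ∧ τ.FirstOrder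
  | fn _ _ => False
  | list _ => False

/-- Typing contexts, with variables named by position; the most recent variable comes first. -/
abbrev Ctx (P : Type v₁) := List (Ty P)

/-- A context is first-order if all its types are. -/
def Ctx.FirstOrder {P : Type v₁} (Γ : Ctx P) : Prop := ∀ σ ∈ Γ, Ty.FirstOrder σ

/-- Variables `x : τ ∈ Γ`. -/
inductive Var {P : Type v₁} : Ctx P → Ty P → Type v₁
  | zero {Γ : Ctx P} {τ : Ty P} : Var (τ :: Γ) τ
  | succ {Γ : Ctx P} {σ τ : Ty P} (x : Var Γ τ) : Var (σ :: Γ) τ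

/-- Well-typed terms `Γ ⊢ M : τ` over a signature: one constructor for each typing rule. -/
inductive Tm (S : Signature.{v₁, v₂}) : Ctx S.PrimTy → Ty S.PrimTy → Type (max v₁ v₂)
  | var {Γ : Ctx S.PrimTy} {τ : Ty S.PrimTy} (x : Var Γ τ) : Tm S Γ τ
  | op {Γ : Ctx S.PrimTy} {ρs : List S.PrimTy} {ρ : S.PrimTy} (φ : S.Op ρs ρ)
      (ts : ∀ i : Fin ρs.length, Tm S Γ (.prim (ρs.get i))) : Tm S Γ (.prim ρ)
  | inl {Γ : Ctx S.PrimTy} {σ τ : Ty S.PrimTy} (t : Tm S Γ σ) : Tm S Γ (.sum σ τ)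
  | inr {Γ : Ctx S.PrimTy} {σ τ : Ty S.PrimTy} (t : Tm S Γ τ) : Tm S Γ (.sum σ τ)
  | case {Γ : Ctx S.PrimTy} {σ τ τ' : Ty S.PrimTy} (s : Tm S Γ (.sum σ τ))
      (t₁ : Tm S (σ :: Γ) τ') (t₂ : Tm S (τ :: Γ) τ') : Tm S Γ τ'
  | unit {Γ : Ctx S.PrimTy} : Tm S Γ .unit
  | pair {Γ : Ctx S.PrimTy} {σ τ : Ty S.PrimTy} (s : Tm S Γ σ) (t : Tm S Γ τ) :
      Tm S Γ (.prod σ τ)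
  | fst {Γ : Ctx S.PrimTy} {σ τ : Ty S.PrimTy} (t : Tm S Γ (.prod σ τ)) : Tm S Γ σ
  | snd {Γ : Ctx S.PrimTy} {σ τ : Ty S.PrimTy} (t : Tm S Γ (.prod σ τ)) : Tm S Γ τ
  | lam {Γ : Ctx S.PrimTy} {σ τ : Ty S.PrimTy} (t : Tm S (σ :: Γ) τ) : Tm S Γ (.fn σ τ)
  | app {Γ : Ctx S.PrimTy} {σ τ : Ty S.PrimTy} (s : Tm S Γ (.fn σ τ)) (t : Tm S Γ σ) : Tm S Γ τ
  | nil {Γ : Ctx S.PrimTy} {τ : Ty S.PrimTy} : Tm S Γ (.list τ)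
  | cons {Γ : Ctx S.PrimTy} {τ : Ty S.PrimTy} (s : Tm S Γ τ) (t : Tm S Γ (.list τ)) :
      Tm S Γ (.list τ)
  | fold {Γ : Ctx S.PrimTy} {σ τ : Ty S.PrimTy} (s₁ : Tm S Γ τ) (s₂ : Tm S (τ :: σ :: Γ) τ)
      (t : Tm S Γ (.list σ)) : Tm S Γ τ

/-! ### Categorical structure used by the interpretation -/

section Structure

variable {C : Type u₁} [Category.{v₁} C] [CartesianMonoidalCategory C]

/-- The product of a finite list of objects. -/
@[reducible] def listProd : List C → C
  | [] => 𝟙_ C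
  | X :: Xs => X ⊗ listProd Xs

/-- Tupling into the product of a finite list of objects. -/
def listTuple {P : Type u₂} (A : P → C) {X : C} :
    (ρs : List P) → (∀ i : Fin ρs.length, X ⟶ A (ρs.get i)) → (X ⟶ listProd (ρs.map A))
  | [], _ => toUnit X
  | _ :: ρs, f => lift (f 0) (listTuple A ρs fun i => f i.succ)

/-- The power `Xⁿ`, with `X⁰ = 1` and `Xⁿ⁺¹ = X × Xⁿ`. -/
@[reducible] def power (X : C) : ℕ → C
  | 0 => 𝟙_ C
  | n + 1 => X ⊗ power X n

/-- The list object `∐ n, Xⁿ`. -/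
@[reducible] noncomputable def listObj [HasCoproductsOfShape ℕ C] (X : C) : C := ∐ power X

/-- The empty list. -/
noncomputable def nilHom [HasCoproductsOfShape ℕ C] (X : C) : 𝟙_ C ⟶ listObj X :=
  Sigma.ι (power X) 0

variable [MonoidalClosed C]

/-- Adding an element to a list: on the summand `X × Xⁿ` of `X × List X` it is the inclusion of
`Xⁿ⁺¹` into `List X`. -/
noncomputable def consHom [HasCoproductsOfShape ℕ C] (X : C) : X ⊗ listObj X ⟶ listObj X :=
  MonoidalClosed.uncurry (Sigma.desc fun n =>
    MonoidalClosed.curry (Sigma.ι (power X) (n + 1) : X ⊗ power X n ⟶ listObj X))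

/-- Folding over the summand `Xⁿ` of `List X`. -/
def foldPower {G X Y : C} (f : G ⟶ Y) (g : (G ⊗ X) ⊗ Y ⟶ Y) : (n : ℕ) → (G ⊗ power X n ⟶ Y)
  | 0 => fst G (𝟙_ C) ≫ f
  | n + 1 => lift (lift (fst G (X ⊗ power X n)) (snd G (X ⊗ power X n) ≫ fst X (power X n)))
      (lift (fst G (X ⊗ power X n)) (snd G (X ⊗ power X n) ≫ snd X (power X n)) ≫
        foldPower f g n) ≫ g

/-- The parameterised fold over lists. -/
noncomputable def foldHom [HasCoproductsOfShape ℕ C] {G X Y : C} (f : G ⟶ Y)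
    (g : (G ⊗ X) ⊗ Y ⟶ Y) : G ⊗ listObj X ⟶ Y :=
  MonoidalClosed.uncurry (Sigma.desc fun n => MonoidalClosed.curry (foldPower f g n))

/-- The parameterised copairing. -/
noncomputable def copair [HasFiniteCoproducts C] {G X Y Z : C} (f : G ⊗ X ⟶ Z) (g : G ⊗ Y ⟶ Z) :
    G ⊗ (X ⨿ Y) ⟶ Z :=
  MonoidalClosed.uncurry (coprod.desc (MonoidalClosed.curry f) (MonoidalClosed.curry g))

/-- Currying in the last variable. -/
def lambda {G X Y : C} (f : G ⊗ X ⟶ Y) : G ⟶ (ihom X).obj Y :=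
  MonoidalClosed.curry (lift (snd X G) (fst X G) ≫ f)

/-- Application of a function to an argument. -/
def eval {G X Y : C} (f : G ⟶ (ihom X).obj Y) (a : G ⟶ X) : G ⟶ Y :=
  lift a f ≫ (ihom.ev X).app Y

end Structure

/-! ### Interpretations -/

/-- An interpretation of a signature in a category with finite products. -/
structure Interp (S : Signature.{w, v}) (C : Type u₁) [Category.{v₁} C]
    [CartesianMonoidalCategory C] where
  prim : S.PrimTy → C
  op {ρs : List S.PrimTy} {ρ : S.PrimTy} (φ : S.Op ρs ρ) : listProd (ρs.map prim) ⟶ prim ρ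

namespace Interp

variable {S : Signature.{w, v}} {C : Type u₁} [Category.{v₁} C] [CartesianMonoidalCategory C]
  {D : Type u₂} [Category.{v₂} D] [CartesianMonoidalCategory D]

section FirstOrder

variable [HasFiniteCoproducts C] (I : Interp S C)

/-- The interpretation of first-order types, in any category with finite products and
coproducts. -/
@[reducible] noncomputable def foTy : (τ : Ty S.PrimTy) → τ.FirstOrder → C
  | .prim ρ, _ => I.prim ρ
  | .sum σ τ, h => foTy σ h.1 ⨿ foTy τ h.2
  | .unit, _ => 𝟙_ C
  | .prod σ τ, h => foTy σ h.1 ⊗ foTy τ h.2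

/-- The interpretation of first-order contexts. -/
@[reducible] noncomputable def foCtx : (Γ : Ctx S.PrimTy) → Γ.FirstOrder → C
  | [], _ => 𝟙_ C
  | σ :: Γ, h => foCtx Γ (List.forall_mem_cons.1 h).2 ⊗ I.foTy σ (List.forall_mem_cons.1 h).1

end FirstOrder

section HigherOrder

variable [MonoidalClosed C] [HasFiniteCoproducts C] [HasCoproductsOfShape ℕ C] (I : Interp S C)

/-- The interpretation of types in a bicartesian closed category with list objects. -/
@[reducible] noncomputable def ty : Ty S.PrimTy → C
  | .prim ρ => I.prim ρ
  | .sum σ τ => ty σ ⨿ ty τ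
  | .unit => 𝟙_ C
  | .prod σ τ => ty σ ⊗ ty τ
  | .fn σ τ => (ihom (ty σ)).obj (ty τ)
  | .list τ => listObj (ty τ)

/-- The interpretation of contexts. -/
@[reducible] noncomputable def ctx : Ctx S.PrimTy → C
  | [] => 𝟙_ C
  | σ :: Γ => ctx Γ ⊗ I.ty σ

/-- The interpretation of variables as projections. -/
noncomputable def var {τ : Ty S.PrimTy} : {Γ : Ctx S.PrimTy} → Var Γ τ → (I.ctx Γ ⟶ I.ty τ)
  | _ :: Γ, .zero => CartesianMonoidalCategory.snd (I.ctx Γ) (I.ty τ)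
  | σ :: Γ, .succ x => CartesianMonoidalCategory.fst (I.ctx Γ) (I.ty σ) ≫ var x

/-- The interpretation of terms `Γ ⊢ M : τ` as morphisms `⟦Γ⟧ ⟶ ⟦τ⟧`. -/
noncomputable def tm : {Γ : Ctx S.PrimTy} → {τ : Ty S.PrimTy} → Tm S Γ τ → (I.ctx Γ ⟶ I.ty τ)
  | _, _, .var x => I.var x
  | _, _, .op (ρs := ρs) φ ts => listTuple I.prim ρs (fun i => tm (ts i)) ≫ I.op φ
  | _, _, .inl t => tm t ≫ coprod.inl
  | _, _, .inr t => tm t ≫ coprod.inr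
  | Γ, _, .case s t₁ t₂ => lift (𝟙 (I.ctx Γ)) (tm s) ≫ copair (tm t₁) (tm t₂)
  | Γ, _, .unit => toUnit (I.ctx Γ)
  | _, _, .pair s t => lift (tm s) (tm t)
  | _, _, .fst (σ := σ) (τ := τ) t => tm t ≫ CartesianMonoidalCategory.fst (I.ty σ) (I.ty τ)
  | _, _, .snd (σ := σ) (τ := τ) t => tm t ≫ CartesianMonoidalCategory.snd (I.ty σ) (I.ty τ)
  | _, _, .lam t => lambda (tm t)
  | _, _, .app s t => eval (tm s) (tm t)
  | Γ, _, .nil (τ := τ) => toUnit (I.ctx Γ) ≫ nilHom (I.ty τ)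
  | _, _, .cons (τ := τ) s t => lift (tm s) (tm t) ≫ consHom (I.ty τ)
  | Γ, _, .fold s₁ s₂ t => lift (𝟙 (I.ctx Γ)) (tm t) ≫ foldHom (tm s₁) (tm s₂)

end HigherOrder

section Transport

variable (F : C ⥤ D) [PreservesFiniteProducts F]

/-- A functor preserving finite products preserves products of finite lists of objects. -/
noncomputable def listProdIso {P : Type w} (A : P → C) :
    (ρs : List P) → (F.obj (listProd (ρs.map A)) ≅ listProd (ρs.map fun ρ => F.obj (A ρ)))
  | [] => preservesTerminalIso F
  | ρ :: ρs => prodComparisonIso F (A ρ) (listProd (ρs.map A)) ≪≫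
      (Iso.refl (F.obj (A ρ)) ⊗ᵢ listProdIso A ρs)

/-- The transport of an interpretation along a functor preserving finite products. -/
@[reducible] noncomputable def map (I : Interp S C) : Interp S D where
  prim ρ := F.obj (I.prim ρ)
  op {ρs _} φ := (listProdIso F I.prim ρs).inv ≫ F.map (I.op φ)

variable [PreservesFiniteCoproducts F] [HasFiniteCoproducts C]
  [MonoidalClosed D] [HasFiniteCoproducts D] [HasCoproductsOfShape ℕ D] (I : Interp S C)

/-- The canonical isomorphism `F ⟦τ⟧_fo ≅ ⟦τ⟧` for first-order types. -/
noncomputable def tyIso : (τ : Ty S.PrimTy) → (h : τ.FirstOrder) →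
    (F.obj (I.foTy τ h) ≅ (I.map F).ty τ)
  | .prim ρ, _ => Iso.refl (F.obj (I.prim ρ))
  | .sum σ τ, h => (PreservesColimitPair.iso F (I.foTy σ h.1) (I.foTy τ h.2)).symm ≪≫
      coprod.mapIso (tyIso σ h.1) (tyIso τ h.2)
  | .unit, _ => preservesTerminalIso F
  | .prod σ τ, h => prodComparisonIso F (I.foTy σ h.1) (I.foTy τ h.2) ≪≫
      (tyIso σ h.1 ⊗ᵢ tyIso τ h.2)

/-- The canonical isomorphism `F ⟦Γ⟧_fo ≅ ⟦Γ⟧` for first-order contexts. -/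
noncomputable def ctxIso : (Γ : Ctx S.PrimTy) → (h : Γ.FirstOrder) →
    (F.obj (I.foCtx Γ h) ≅ (I.map F).ctx Γ)
  | [], _ => preservesTerminalIso F
  | σ :: Γ, h => prodComparisonIso F (I.foCtx Γ (List.forall_mem_cons.1 h).2)
        (I.foTy σ (List.forall_mem_cons.1 h).1) ≪≫
      (ctxIso Γ (List.forall_mem_cons.1 h).2 ⊗ᵢ tyIso F I σ (List.forall_mem_cons.1 h).1)

end Transport

/-- The interpretation of a term of first-order type in first-order context in
`Fam(MeetSLat × JoinSLatᵒᵖ)`, read through the canonical isomorphisms as a morphism between the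
images of the first-order interpretations of `Γ` and `τ` in `Fam(LatGal)`. -/
noncomputable def foTm (I : Interp S (Fam.{u} LatGal.{u})) {Γ : Ctx S.PrimTy} {τ : Ty S.PrimTy}
    (hΓ : Γ.FirstOrder) (hτ : τ.FirstOrder) (M : Tm S Γ τ) :
    H.{u}.obj (I.foCtx Γ hΓ) ⟶ H.{u}.obj (I.foTy τ hτ) :=
  (I.ctxIso H.{u} Γ hΓ).hom ≫ (I.map H.{u}).tm M ≫ (I.tyIso H.{u} τ hτ).inv

end Interp

end GaloisSlicing

open GaloisSlicing

namespace GaloisSlicing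

/-! ### Maps out of connected objects -/

/-! The obstacle is that a subterm of higher type denotes a morphism of $\mathcal D$ about which $H$
says nothing: no compatibility of $H$ with exponentials is available. The remedy is a Kripke logical
relation `Interp.rel`, with objects $X$ of $\mathrm{Fam}(\mathrm{LatGal})$ as worlds and predicates
on morphisms $H(X)\to[\![\tau]\!]$. At a primitive type the predicate says "in the image of $H$";
the other clauses follow the type. The fundamental lemma `Interp.rel_tm` then holds for every term,
by induction, at every world.

The relation has to be compared with the image of $H$ at first-order types (`Interp.rel_iff`). Sums
are the difficulty: the relation demands a factorization through one injection, and a general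
morphism $X\to A+B$ has none. It exists when $X$ is connected, in particular when $X$ is a
one-object family. So the fundamental lemma is not applied to the identity of
$[\![\Gamma]\!]_{\mathit{fo}}$, but to the inclusion of each of its fibers. Each restriction of the
denotation of $M$ is therefore in the image of $H$.

These restrictions glue: $H$ leaves index functions alone and acts on each component separately, so
a morphism of families is in its image as soon as every component is a pair of adjoints
(`Fam.exists_map_eq`). -/

/-- Every morphism from `X` to a binary coproduct factors through an injection. -/
def SplitsCoproducts {C : Type u₁} [Category.{v₁} C] [HasFiniteCoproducts C] (X : C) : Prop :=
  ∀ {A B : C} (m : X ⟶ A ⨿ B),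
    (∃ a : X ⟶ A, m = a ≫ coprod.inl) ∨ ∃ b : X ⟶ B, m = b ≫ coprod.inr

section Fam

variable {C : Type u₁} [Category.{v₁} C]

/-- A morphism from a one-object family to a coproduct of families factors through an
injection. -/
theorem Fam.exists_eq_comp_inj {J : Type} {f : J → Fam.{w} C} {c : Cofan f} (hc : IsColimit c)
    {X : Fam.{w} C} [Unique X.I] (m : X ⟶ c.pt) : ∃ (j : J) (a : X ⟶ f j), m = a ≫ c.inj j := by
  let f' : ULift.{w} J → Fam.{w} C := fun j => f j.down
  -- The explicit coproduct is indexed by pairs $(j,i)$, so a map from a one-index family visibly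
  -- selects one $j$. The comparison maps `p` and `q` transfer this to an arbitrary coproduct;
  -- `ULift` only adjusts the universe of `J`.
  let S := FormalCoproduct.cofan (ULift.{w} J) f'
  let hS : IsColimit S := FormalCoproduct.isColimitCofan _ _
  let p : c.pt ⟶ S.pt := Cofan.IsColimit.desc hc fun j => S.inj ⟨j⟩
  let q : S.pt ⟶ c.pt := Cofan.IsColimit.desc hS fun j => c.inj j.down
  have hS' (j : ULift.{w} J) : S.inj j ≫ q = c.inj j.down := Cofan.IsColimit.fac hS _ j
  have hpq : p ≫ q = 𝟙 _ := Cofan.IsColimit.hom_ext hc _ _ fun j => by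
    have h : c.inj j ≫ p = S.inj ⟨j⟩ := Cofan.IsColimit.fac hc _ j
    rw [reassoc_of% h, hS', Category.comp_id]
  obtain ⟨j, a, h⟩ : ∃ (j : ULift.{w} J) (a : X ⟶ f' j), m ≫ p = a ≫ S.inj j := by
    generalize m ≫ p = k
    -- All indices equal `default`, but only propositionally; the `eqToHom` moves the component at
    -- `i` to the target chosen at `default`.
    refine ⟨(k.f default).1, ⟨fun _ => (k.f default).2, fun i =>
      k.φ i ≫ eqToHom (by rw [Unique.eq_default i]; rfl)⟩, ?_⟩
    refine FormalCoproduct.hom_ext (funext fun i => by rw [Unique.eq_default i]; rfl) fun i => ?_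
    obtain rfl := Unique.eq_default i
    exact (Category.comp_id _).symm
  refine ⟨j.down, a, ?_⟩
  rw [← hS' j, ← reassoc_of% h, hpq, Category.comp_id]

theorem Fam.splitsCoproducts (X : Fam.{w} C) [Unique X.I] : SplitsCoproducts X := by
  intro A B m
  -- The binary coproduct is repackaged as a coproduct of a family indexed by a type, with the same
  -- injections.
  let c : Cofan (fun j : WalkingPair => (pair A B).obj ⟨j⟩) :=
    Cofan.mk (A ⨿ B) fun j => colimit.ι (pair A B) ⟨j⟩
  have hc : IsColimit c := IsColimit.ofIsoColimit (colimit.isColimit (pair A B))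
    (Cocone.ext (Iso.refl _) fun j => by rcases j with ⟨_ | _⟩ <;> exact Category.comp_id _)
  obtain ⟨_ | _, a, h⟩ := Fam.exists_eq_comp_inj hc m
  · exact .inl ⟨a, h⟩
  · exact .inr ⟨a, h⟩

/-- The one-object family at an index of a family. -/
def Fam.fiber (X : Fam.{w} C) (x : X.I) : Fam.{w} C := ⟨PUnit, fun _ => X.obj x⟩

instance (X : Fam.{w} C) (x : X.I) : Unique (X.fiber x).I := inferInstanceAs (Unique PUnit)

/-- The inclusion of the one-object family at an index. -/
def Fam.fiberι (X : Fam.{w} C) (x : X.I) : X.fiber x ⟶ X := ⟨fun _ => x, fun _ => 𝟙 _⟩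

end Fam

/-! ### Computation rules along generalized elements -/

section Structure

variable {C : Type u₁} [Category.{v₁} C] [CartesianMonoidalCategory C]

theorem comp_listTuple {P : Type u₂} (A : P → C) {X Y : C} (γ : Y ⟶ X) : (ρs : List P) →
    (f : ∀ i : Fin ρs.length, X ⟶ A (ρs.get i)) →
    γ ≫ listTuple A ρs f = listTuple A ρs fun i => γ ≫ f i
  | [], _ => toUnit_unique _ _
  | _ :: ρs, _ =>
    (comp_lift _ _ _).trans (congrArg (lift _) (comp_listTuple A γ ρs _))

variable [MonoidalClosed C]

/-- Naturality of uncurrying in its left variable. `copair`, `consHom` and `foldHom` are all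
uncurried cotuples, so this moves an injection to where it meets the cotuple and selects a branch.
-/
theorem lift_comp_uncurry {G X Y Z W : C} (γ : W ⟶ G) (a : W ⟶ X) (i : X ⟶ Y)
    (h : Y ⟶ (ihom G).obj Z) :
    lift γ (a ≫ i) ≫ MonoidalClosed.uncurry h = lift γ a ≫ MonoidalClosed.uncurry (i ≫ h) := by
  rw [MonoidalClosed.uncurry_natural_left, lift_whiskerLeft_assoc]

theorem lift_inl_copair [HasFiniteCoproducts C] {W G X Y Z : C} (γ : W ⟶ G) (a : W ⟶ X)
    (f : G ⊗ X ⟶ Z) (g : G ⊗ Y ⟶ Z) :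
    lift γ (a ≫ coprod.inl) ≫ copair f g = lift γ a ≫ f := by
  rw [copair, lift_comp_uncurry]; erw [coprod.inl_desc]; rw [MonoidalClosed.uncurry_curry]

theorem lift_inr_copair [HasFiniteCoproducts C] {W G X Y Z : C} (γ : W ⟶ G) (b : W ⟶ Y)
    (f : G ⊗ X ⟶ Z) (g : G ⊗ Y ⟶ Z) :
    lift γ (b ≫ coprod.inr) ≫ copair f g = lift γ b ≫ g := by
  rw [copair, lift_comp_uncurry]; erw [coprod.inr_desc]; rw [MonoidalClosed.uncurry_curry]

theorem lift_ι_consHom [HasCoproductsOfShape ℕ C] {W X : C} (a : W ⟶ X) (n : ℕ)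
    (b : W ⟶ power X n) :
    lift a (b ≫ Sigma.ι (power X) n) ≫ consHom X =
      (lift a b : W ⟶ power X (n + 1)) ≫ Sigma.ι (power X) (n + 1) := by
  simp [consHom, lift_comp_uncurry]

theorem lift_ι_foldHom [HasCoproductsOfShape ℕ C] {W G X Y : C} (γ : W ⟶ G) (n : ℕ)
    (b : W ⟶ power X n) (f : G ⟶ Y) (g : (G ⊗ X) ⊗ Y ⟶ Y) :
    lift γ (b ≫ Sigma.ι (power X) n) ≫ foldHom f g = lift γ b ≫ foldPower f g n := by
  simp [foldHom, lift_comp_uncurry]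

theorem comp_eval {W G X Y : C} (γ : W ⟶ G) (f : G ⟶ (ihom X).obj Y) (a : G ⟶ X) :
    γ ≫ eval f a = eval (γ ≫ f) (γ ≫ a) := by
  simp [eval, ← Category.assoc]

/-- The β-rule under a substitution `γ`. The swap inside `lambda` is needed because the closed
structure curries the left factor, while a context is extended on the right. -/
theorem eval_comp_lambda {W G X Y : C} (γ : W ⟶ G) (t : G ⊗ X ⟶ Y) (a : W ⟶ X) :
    eval (γ ≫ lambda t) a = lift γ a ≫ t := by
  have h : lift a (γ ≫ lambda t) = lift a γ ≫ X ◁ lambda t := by simp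
  rw [eval, h, Category.assoc, ← MonoidalClosed.uncurry_eq, lambda, MonoidalClosed.uncurry_curry,
    comp_lift_assoc, lift_snd, lift_fst]

end Structure

/-! ### Tupling and injections along comparison isomorphisms -/

section Comparison

variable {C : Type u₁} [Category.{v₁} C] {D : Type u₂} [Category.{v₂} D] (F : C ⥤ D)

section Coproducts

variable [HasFiniteCoproducts C] [HasFiniteCoproducts D] [PreservesFiniteCoproducts F]

/-- The comparison isomorphism matches the image of an injection with an injection. The isomorphisms
`e` and `e'` are arbitrary so that the right-hand isomorphism has the shape of the sum clause of
`Interp.tyIso`. -/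
theorem map_inl_comp_preservesColimitPairIso_inv {X A B : C} {A' B' : D} (a : X ⟶ A)
    (e : F.obj A ≅ A') (e' : F.obj B ≅ B') :
    F.map (a ≫ coprod.inl) ≫
      ((PreservesColimitPair.iso F A B).symm ≪≫ coprod.mapIso e e').hom =
      (F.map a ≫ e.hom) ≫ coprod.inl := by
  have h : F.map (coprod.inl : A ⟶ A ⨿ B) ≫ (PreservesColimitPair.iso F A B).inv =
      coprod.inl := by
    simp [Iso.comp_inv_eq]
  rw [F.map_comp, Category.assoc, Iso.trans_hom, Iso.symm_hom, reassoc_of% h]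
  simp

theorem map_inr_comp_preservesColimitPairIso_inv {X A B : C} {A' B' : D} (b : X ⟶ B)
    (e : F.obj A ≅ A') (e' : F.obj B ≅ B') :
    F.map (b ≫ coprod.inr) ≫
      ((PreservesColimitPair.iso F A B).symm ≪≫ coprod.mapIso e e').hom =
      (F.map b ≫ e'.hom) ≫ coprod.inr := by
  have h : F.map (coprod.inr : B ⟶ A ⨿ B) ≫ (PreservesColimitPair.iso F A B).inv =
      coprod.inr := by
    simp [Iso.comp_inv_eq]
  rw [F.map_comp, Category.assoc, Iso.trans_hom, Iso.symm_hom, reassoc_of% h]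
  simp

end Coproducts

variable [CartesianMonoidalCategory C] [CartesianMonoidalCategory D] [PreservesFiniteProducts F]

theorem map_lift_comp_prodComparisonIso {X A B : C} {A' B' : D} (a : X ⟶ A) (b : X ⟶ B)
    (e : F.obj A ≅ A') (e' : F.obj B ≅ B') :
    F.map (lift a b) ≫ (prodComparisonIso F A B ≪≫ (e ⊗ᵢ e')).hom =
      lift (F.map a ≫ e.hom) (F.map b ≫ e'.hom) := by
  refine CartesianMonoidalCategory.hom_ext _ _ ?_ ?_ <;> simp [← F.map_comp_assoc]

theorem map_listTuple {P : Type w} (A : P → C) {X : C} : (ρs : List P) →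
    (k : ∀ i : Fin ρs.length, X ⟶ A (ρs.get i)) →
    F.map (listTuple A ρs k) ≫ (Interp.listProdIso F A ρs).hom =
      listTuple (fun ρ => F.obj (A ρ)) ρs fun i => F.map (k i)
  | [], _ => toUnit_unique _ _
  | _ :: ρs, _ => (map_lift_comp_prodComparisonIso F _ _ (Iso.refl _) _).trans
      (congrArg₂ lift (Category.comp_id _) (map_listTuple A ρs _))

end Comparison

/-! ### The logical relation -/

namespace Interp

variable {S : Signature.{w, v}} {C : Type u₁} [Category.{v₁} C] [CartesianMonoidalCategory C]
  {D : Type u₂} [Category.{v₂} D] [CartesianMonoidalCategory D]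
  (F : C ⥤ D)

/-- The pointwise extension of a predicate to powers. -/
def powerRel {A : D} {W : D} (R : (W ⟶ A) → Prop) : (n : ℕ) → (W ⟶ power A n) → Prop
  | 0, _ => True
  | n + 1, m => R (m ≫ CartesianMonoidalCategory.fst A (power A n)) ∧
      powerRel R n (m ≫ CartesianMonoidalCategory.snd A (power A n))

/-- Two predicates occur because restriction along `h` changes the world. -/
theorem powerRel_comp {A W W' : D} {R : (W ⟶ A) → Prop} {R' : (W' ⟶ A) → Prop} (h : W' ⟶ W)
    (hR : ∀ m, R m → R' (h ≫ m)) :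
    (n : ℕ) → (m : W ⟶ power A n) → powerRel R n m → powerRel R' n (h ≫ m)
  | 0, _, _ => trivial
  | n + 1, m, hm => by
    refine ⟨?_, ?_⟩
    · rw [Category.assoc]; exact hR _ hm.1
    · rw [Category.assoc]; exact powerRel_comp h hR n _ hm.2

variable [PreservesFiniteProducts F]
  [MonoidalClosed D] [HasFiniteCoproducts D] [HasCoproductsOfShape ℕ D] (I : Interp S C)

/-- The Kripke logical relation, over the objects of `C`. At primitive types it
holds for the images of morphisms of `C`. -/
def rel : (τ : Ty S.PrimTy) → (X : C) → (F.obj X ⟶ (I.map F).ty τ) → Prop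
  | .prim ρ, X, m => ∃ k : X ⟶ I.prim ρ, F.map k = m
  -- One injection must serve for the whole of `X`, without passing to a cover; this makes `case`
  -- immediate in the fundamental lemma.
  | .sum σ τ, X, m => (∃ a, rel σ X a ∧ m = a ≫ coprod.inl) ∨ ∃ b, rel τ X b ∧ m = b ≫ coprod.inr
  | .unit, _, _ => True
  | .prod σ τ, X, m =>
    rel σ X (m ≫ CartesianMonoidalCategory.fst ((I.map F).ty σ) ((I.map F).ty τ)) ∧
      rel τ X (m ≫ CartesianMonoidalCategory.snd ((I.map F).ty σ) ((I.map F).ty τ))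
  -- Arguments may live at any world over `X`, which makes the clause stable under restriction by
  -- construction.
  | .fn σ τ, X, m => ∀ (Y : C) (h : Y ⟶ X) (a : F.obj Y ⟶ (I.map F).ty σ),
      rel σ Y a → rel τ Y (eval (F.map h ≫ m) a)
  | .list τ, X, m => ∃ (n : ℕ) (a : F.obj X ⟶ power ((I.map F).ty τ) n),
      powerRel (rel τ X) n a ∧ m = a ≫ Sigma.ι (power ((I.map F).ty τ)) n

/-- The logical relation at contexts. -/
def ctxRel : (Γ : Ctx S.PrimTy) → (X : C) → (F.obj X ⟶ (I.map F).ctx Γ) → Prop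
  | [], _, _ => True
  | σ :: Γ, X, γ =>
    ctxRel Γ X (γ ≫ CartesianMonoidalCategory.fst ((I.map F).ctx Γ) ((I.map F).ty σ)) ∧
      I.rel F σ X (γ ≫ CartesianMonoidalCategory.snd ((I.map F).ctx Γ) ((I.map F).ty σ))

/-- Monotonicity of the Kripke relation. Function types need no induction hypothesis: their clause
absorbs `h` by composition. -/
theorem rel_comp {X Y : C} (h : Y ⟶ X) : (τ : Ty S.PrimTy) → (m : F.obj X ⟶ (I.map F).ty τ) →
    I.rel F τ X m → I.rel F τ Y (F.map h ≫ m)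
  | .prim ρ, m, ⟨k, hk⟩ => ⟨h ≫ k, by rw [F.map_comp, hk]⟩
  | .sum σ τ, m, .inl ⟨a, ha, e⟩ => .inl ⟨_, rel_comp h σ a ha, by rw [e, Category.assoc]⟩
  | .sum σ τ, m, .inr ⟨a, ha, e⟩ => .inr ⟨_, rel_comp h τ a ha, by rw [e, Category.assoc]⟩
  | .unit, _, _ => trivial
  | .prod σ τ, m, ⟨h₁, h₂⟩ => ⟨by rw [Category.assoc]; exact rel_comp h σ _ h₁,
      by rw [Category.assoc]; exact rel_comp h τ _ h₂⟩
  | .fn σ τ, m, hm => fun Z h' a ha => by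
      have := hm Z (h' ≫ h) a ha
      rwa [F.map_comp, Category.assoc] at this
  | .list τ, m, ⟨n, a, ha, e⟩ =>
      ⟨n, _, powerRel_comp _ (rel_comp h τ) n a ha, by rw [e, Category.assoc]⟩

theorem ctxRel_comp {X Y : C} (h : Y ⟶ X) : (Γ : Ctx S.PrimTy) →
    (γ : F.obj X ⟶ (I.map F).ctx Γ) → I.ctxRel F Γ X γ → I.ctxRel F Γ Y (F.map h ≫ γ)
  | [], _, _ => trivial
  | σ :: Γ, m, ⟨h₁, h₂⟩ => ⟨by rw [Category.assoc]; exact ctxRel_comp h Γ _ h₁,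
      by rw [Category.assoc]; exact I.rel_comp F h σ _ h₂⟩

theorem rel_var {τ : Ty S.PrimTy} {X : C} : {Γ : Ctx S.PrimTy} → (x : Var Γ τ) →
    (γ : F.obj X ⟶ (I.map F).ctx Γ) → I.ctxRel F Γ X γ → I.rel F τ X (γ ≫ (I.map F).var x)
  | _ :: _, .zero, _, hγ => hγ.2
  | _ :: _, .succ x, γ, hγ => by
    have := rel_var x _ hγ.1
    rwa [Category.assoc] at this

/-- Induction on the length: the tail is folded by the induction hypothesis, then `hg` adds the
head. The world stays fixed throughout. -/
theorem rel_foldPower {X : C} (σ τ : Ty S.PrimTy) {G : D} (γ : F.obj X ⟶ G)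
    (f : G ⟶ (I.map F).ty τ)
    (g : (G ⊗ (I.map F).ty σ) ⊗ (I.map F).ty τ ⟶ (I.map F).ty τ) (hf : I.rel F τ X (γ ≫ f))
    (hg : ∀ a b, I.rel F σ X a → I.rel F τ X b → I.rel F τ X (lift (lift γ a) b ≫ g)) :
    (n : ℕ) → (m : F.obj X ⟶ power ((I.map F).ty σ) n) → powerRel (I.rel F σ X) n m →
      I.rel F τ X (lift γ m ≫ foldPower f g n)
  | 0, m, _ => by simpa [foldPower] using hf
  | n + 1, m, hm => by
    have := hg _ _ hm.1 (rel_foldPower σ τ γ f g hf hg n _ hm.2)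
    rw [foldPower, ← Category.assoc, comp_lift, comp_lift, comp_lift_assoc, lift_fst, ← Category.assoc, lift_snd, ← Category.assoc, lift_snd]
    exact this

/-- The fundamental lemma of the logical relation. -/
theorem rel_tm {X : C} :
    {Γ : Ctx S.PrimTy} → {τ : Ty S.PrimTy} → (M : Tm S Γ τ) →
    (γ : F.obj X ⟶ (I.map F).ctx Γ) → I.ctxRel F Γ X γ → I.rel F τ X (γ ≫ (I.map F).tm M) := by
  intro Γ τ M
  -- The world must vary: the body of an abstraction is tested at worlds over the current one.
  induction M generalizing X with
  | var x => exact fun γ hγ => I.rel_var F x γ hγ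
  | op φ ts ih =>
    intro γ hγ
    -- At primitive types being related means having a preimage, so the arguments lift to `C` and
    -- the operation can be applied there.
    choose k hk using fun i => ih i γ hγ
    refine ⟨listTuple I.prim _ k ≫ I.op φ, ?_⟩
    have h := map_listTuple F I.prim _ k
    rw [← Iso.eq_comp_inv] at h
    rw [F.map_comp, h, tm, ← Category.assoc γ, comp_listTuple, Category.assoc]
    simp only [hk]
  | inl t ih => exact fun γ hγ => .inl ⟨_, ih γ hγ, (Category.assoc _ _ _).symm⟩
  | inr t ih => exact fun γ hγ => .inr ⟨_, ih γ hγ, (Category.assoc _ _ _).symm⟩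
  | case s t₁ t₂ ih ih₁ ih₂ =>
    intro γ hγ
    rw [tm, comp_lift_assoc, Category.comp_id]
    obtain ⟨a, ha, e⟩ | ⟨a, ha, e⟩ := ih γ hγ
    · rw [e, lift_inl_copair]
      exact ih₁ _ ⟨by rwa [lift_fst], by rwa [lift_snd]⟩
    · rw [e, lift_inr_copair]
      exact ih₂ _ ⟨by rwa [lift_fst], by rwa [lift_snd]⟩
  | unit => exact fun _ _ => trivial
  | pair s t ih₁ ih₂ =>
    intro γ hγ
    rw [tm, comp_lift]
    exact ⟨by rw [lift_fst]; exact ih₁ γ hγ, by rw [lift_snd]; exact ih₂ γ hγ⟩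
  | fst t ih =>
    intro γ hγ
    rw [tm, ← Category.assoc]
    exact (ih γ hγ).1
  | snd t ih =>
    intro γ hγ
    rw [tm, ← Category.assoc]
    exact (ih γ hγ).2
  | lam t ih =>
    intro γ hγ Y h a ha
    rw [tm, ← Category.assoc, eval_comp_lambda]
    -- The environment is restricted along `h` to the world of the argument `a`, then extended by
    -- `a`.
    exact ih _ ⟨by rw [lift_fst]; exact I.ctxRel_comp F h _ γ hγ, by rwa [lift_snd]⟩
  | app s t ih₁ ih₂ =>
    intro γ hγ
    -- The function clause is used at the current world, along the identity.
    have := ih₁ γ hγ X (𝟙 X) _ (ih₂ γ hγ)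
    rw [F.map_id, Category.id_comp] at this
    rwa [tm, comp_eval]
  | nil =>
    intro γ hγ
    exact ⟨0, toUnit _, trivial, by rw [tm, ← Category.assoc, comp_toUnit]; rfl⟩
  | cons s t ih₁ ih₂ =>
    intro γ hγ
    obtain ⟨n, a, ha, e⟩ := ih₂ γ hγ
    refine ⟨n + 1, lift (γ ≫ (I.map F).tm s) a,
      ⟨by rw [lift_fst]; exact ih₁ γ hγ, by rwa [lift_snd]⟩, ?_⟩
    rw [tm, comp_lift_assoc, e, lift_ι_consHom]
  | fold s₁ s₂ t ih₁ ih₂ ih =>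
    intro γ hγ
    obtain ⟨n, a, ha, e⟩ := ih γ hγ
    rw [tm, comp_lift_assoc, Category.comp_id, e, lift_ι_foldHom]
    refine I.rel_foldPower F _ _ γ _ _ (ih₁ γ hγ) (fun b c hb hc => ?_) n a ha
    exact ih₂ _ ⟨⟨by simpa using hγ, by simpa using hb⟩, by simpa using hc⟩

/-! ### First-order types: the relation and the image of the functor -/

variable [HasFiniteCoproducts C] [PreservesFiniteCoproducts F]

/-- At first-order types the logical relation holds exactly for the images of morphisms of `C`. -/
theorem rel_iff {X : C} (hX : SplitsCoproducts X) : (τ : Ty S.PrimTy) → (hτ : τ.FirstOrder) →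
    (m : F.obj X ⟶ (I.map F).ty τ) →
    (I.rel F τ X m ↔ ∃ k : X ⟶ I.foTy τ hτ, F.map k ≫ (I.tyIso F τ hτ).hom = m)
  | .prim ρ, _, m => by simp [rel, tyIso]
  | .sum σ τ, hτ, m => by
    have hinl (a : X ⟶ I.foTy σ hτ.1) : F.map (a ≫ coprod.inl) ≫ (I.tyIso F (.sum σ τ) hτ).hom =
        (F.map a ≫ (I.tyIso F σ hτ.1).hom) ≫ coprod.inl :=
      map_inl_comp_preservesColimitPairIso_inv F _ _ _
    have hinr (a : X ⟶ I.foTy τ hτ.2) : F.map (a ≫ coprod.inr) ≫ (I.tyIso F (.sum σ τ) hτ).hom =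
        (F.map a ≫ (I.tyIso F τ hτ.2).hom) ≫ coprod.inr :=
      map_inr_comp_preservesColimitPairIso_inv F _ _ _
    constructor
    · rintro (⟨a, ha, rfl⟩ | ⟨a, ha, rfl⟩)
      · obtain ⟨k, rfl⟩ := (rel_iff hX σ hτ.1 a).1 ha
        exact ⟨_, hinl k⟩
      · obtain ⟨k, rfl⟩ := (rel_iff hX τ hτ.2 a).1 ha
        exact ⟨_, hinr k⟩
    · rintro ⟨k, rfl⟩
      -- The one essential use of connectedness. The passage from the relation to the image only
      -- ever calls itself, and never this case.
      obtain ⟨a, rfl⟩ | ⟨a, rfl⟩ := hX k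
      · exact .inl ⟨_, (rel_iff hX σ hτ.1 _).2 ⟨a, rfl⟩, hinl a⟩
      · exact .inr ⟨_, (rel_iff hX τ hτ.2 _).2 ⟨a, rfl⟩, hinr a⟩
  | .unit, _, m => ⟨fun _ => ⟨toUnit _, toUnit_unique _ _⟩, fun _ => trivial⟩
  | .prod σ τ, hτ, m => by
    have hfst (k : X ⟶ I.foTy σ hτ.1 ⊗ I.foTy τ hτ.2) :
        (F.map k ≫ (I.tyIso F (.prod σ τ) hτ).hom) ≫ CartesianMonoidalCategory.fst _ _ =
          F.map (k ≫ CartesianMonoidalCategory.fst _ _) ≫ (I.tyIso F σ hτ.1).hom := by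
      simp [tyIso]
    have hsnd (k : X ⟶ I.foTy σ hτ.1 ⊗ I.foTy τ hτ.2) :
        (F.map k ≫ (I.tyIso F (.prod σ τ) hτ).hom) ≫ CartesianMonoidalCategory.snd _ _ =
          F.map (k ≫ CartesianMonoidalCategory.snd _ _) ≫ (I.tyIso F τ hτ.2).hom := by
      simp [tyIso]
    constructor
    · rintro ⟨h₁, h₂⟩
      obtain ⟨a, ha⟩ := (rel_iff hX σ hτ.1 _).1 h₁
      obtain ⟨b, hb⟩ := (rel_iff hX τ hτ.2 _).1 h₂
      refine ⟨lift a b, CartesianMonoidalCategory.hom_ext _ _ ?_ ?_⟩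
      · rw [hfst, lift_fst, ha]
      · rw [hsnd, lift_snd, hb]
    · rintro ⟨k, rfl⟩
      exact ⟨(rel_iff hX σ hτ.1 _).2 ⟨_, (hfst k).symm⟩,
        (rel_iff hX τ hτ.2 _).2 ⟨_, (hsnd k).symm⟩⟩

/-- Supplies the initial environment for the fundamental lemma: each variable of the context is a
projection of `k`, hence in the image, hence related. -/
theorem ctxRel_map {X : C} (hX : SplitsCoproducts X) : (Γ : Ctx S.PrimTy) → (hΓ : Γ.FirstOrder) →
    (k : X ⟶ I.foCtx Γ hΓ) → I.ctxRel F Γ X (F.map k ≫ (I.ctxIso F Γ hΓ).hom)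
  | [], _, _ => trivial
  | σ :: Γ, hΓ, k => by
    have hΓ' := List.forall_mem_cons.1 hΓ
    refine ⟨?_, (I.rel_iff F hX σ hΓ'.1 _).2
      ⟨k ≫ CartesianMonoidalCategory.snd (I.foCtx Γ hΓ'.2) (I.foTy σ hΓ'.1), by simp [ctxIso]⟩⟩
    have := ctxRel_map hX Γ hΓ'.2
      (k ≫ CartesianMonoidalCategory.fst (I.foCtx Γ hΓ'.2) (I.foTy σ hΓ'.1))
    simpa [ctxIso] using this

/-- Along every connected object over `⟦Γ⟧_fo`, the interpretation of a first-order term is the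
image of a morphism of `C`. -/
theorem exists_map_eq {X : C} (hX : SplitsCoproducts X)
    {Γ : Ctx S.PrimTy} {τ : Ty S.PrimTy} (hΓ : Γ.FirstOrder) (hτ : τ.FirstOrder) (M : Tm S Γ τ)
    (x : X ⟶ I.foCtx Γ hΓ) :
    ∃ k : X ⟶ I.foTy τ hτ, F.map k =
      F.map x ≫ (I.ctxIso F Γ hΓ).hom ≫ (I.map F).tm M ≫ (I.tyIso F τ hτ).inv := by
  obtain ⟨k, hk⟩ := (I.rel_iff F hX τ hτ _).1
    (I.rel_tm F M _ (I.ctxRel_map F hX Γ hΓ x))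
  refine ⟨k, ?_⟩
  rw [← Iso.eq_comp_inv] at hk
  simpa using hk

end Interp

/-! ### Gluing over the indices of a family -/

/-- A morphism between images under `Fam.map F` is in the image if it is so at every index. -/
theorem Fam.exists_map_eq {C : Type u₁} [Category.{v₁} C] {D : Type u₂} [Category.{v₂} D]
    (F : C ⥤ D) {X Y : Fam.{w} C} (m : (Fam.map F).obj X ⟶ (Fam.map F).obj Y)
    (h : ∀ x, ∃ k : X.fiber x ⟶ Y, (Fam.map F).map k = (Fam.map F).map (X.fiberι x) ≫ m) :
    ∃ g : X ⟶ Y, (Fam.map F).map g = m := by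
  have key (x : X.I) : ∃ k : X.obj x ⟶ Y.obj (m.f x), F.map k = m.φ x := by
    obtain ⟨k, hk⟩ := h x
    -- Restriction to the fiber at `x` keeps exactly the value `m.f x` and the component `m.φ x`.
    have hk' : (Fam.map F).map k = ⟨fun _ => m.f x, fun _ => m.φ x⟩ :=
      hk.trans (Fam.mk_ext _ fun _ =>
        (congrArg (· ≫ m.φ x) (F.map_id _)).trans (Category.id_comp _))
    -- The type of `φ` depends on `f`, so the index functions are identified before the components
    -- are compared.
    obtain ⟨f, φ⟩ := k
    have hf : f = fun _ => m.f x := congrArg FormalCoproduct.Hom.f hk'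
    subst hf
    refine ⟨φ PUnit.unit, ?_⟩
    injection hk' with _ h₂
    exact congrFun h₂ PUnit.unit
  choose k hk using key
  exact ⟨⟨m.f, k⟩, Fam.mk_ext m.f hk⟩

end GaloisSlicing

theorem mainTheorem1 (S : Signature.{v₁, v₂}) (I : Interp S (Fam.{u} LatGal.{u}))
    (Γ : Ctx S.PrimTy) (τ : Ty S.PrimTy) (hΓ : Γ.FirstOrder) (hτ : τ.FirstOrder)
    (M : Tm S Γ τ) :
    (∃ g : I.foCtx Γ hΓ ⟶ I.foTy τ hτ,
      H.{u}.map g = (I.ctxIso H.{u} Γ hΓ).hom ≫ (I.map H.{u}).tm M ≫ (I.tyIso H.{u} τ hτ).inv) ∧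
    ∀ x : (I.foCtx Γ hΓ).I,
      GaloisConnection
        (α := ((I.foTy τ hτ).obj ((I.foTm hΓ hτ M).f x)).carrier)
        (β := ((I.foCtx Γ hΓ).obj x).carrier)
        (MeetJoin.bwd ((I.foTm hΓ hτ M).φ x))
        (MeetJoin.fwd ((I.foTm hΓ hτ M).φ x)) := by
  obtain ⟨g, hg⟩ := Fam.exists_map_eq LatGal.toMeetJoin (I.foTm hΓ hτ M) fun x =>
    I.exists_map_eq H.{u} (Fam.splitsCoproducts _) hΓ hτ M (Fam.fiberι _ x)
  refine ⟨⟨g, hg⟩, fun x => ?_⟩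
  -- For a morphism in the image of `H`, the two approximation maps are by definition the adjoints
  -- stored in `g.φ x`.
  rw [← hg]
  exact (g.φ x).gc
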